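/- Let $C$ be a finite set of orientations (unit vectors in the plane $\mathbb R^2$) such that $-c\in C$ for every $c\in C$ and such that for any two points $p,q\in\mathbb R^2$ there is a directed path from $p$ to $q$ with at most two links (edges) whose orientations belong to $C$. Let $e_1,\dots,e_n$ ($n\ge 0$) be pairwise disjoint closed segments of positive length in the plane, each parallel to some orientation of $C$, and let $s,t$ be points that lie on none of these segments; put $e_0=\{s\}$ and $e_{n+1}=\{t\}$. For $0\le i\le n+1$, a path to $e_i$ is a polygonal path that starts at $s$, ends at a point of $e_i$, has all its links oriented in orientations of $C$, and visits $e_1,\dots,e_i$ in this order, i.e. there are points $p_1,\dots,p_i$ appearing in this order along the path with $p_j\in e_j$ for $1\le j\le i$. Its length is its number of links; links of zero length are allowed (the path may turn at a point without being extended). Let $l(e_i)$ be the minimum length of a path to $e_i$; in particular $l(e_0)=0$. For $c\in C$, let $I(e_i,c)$ (respectively $I^+(e_i,c)$) be the set of maximal intervals (inclusion-maximal non-empty convex subsets, where a single point counts as an interval) of the set of all points of $e_i$ that are endpoints of paths to $e_i$ of length exactly $l(e_i)$ (respectively $l(e_i)+1$) whose last link has orientation $c$; here the path without links, which consists of one point,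 is regarded as having every orientation $c\in C$. Then for every $0\le i\le n+1$ and every $c\in C$, the sets $I(e_i,c)$ and $I^+(e_i,c)$ are finite and $$|I(e_i,c)|\le 2i+1\qquad\text{and}\qquad |I^+(e_i,c)|\le 2i+1 .$$ -/

import Mathlib

/-- The Euclidean plane. -/
abbrev Plane : Type := EuclideanSpace ℝ (Fin 2)

/-- The input of the minimum-link tour problem: a finite set `C` of orientations (unit vectors),
closed under taking opposites, such that any two points are joined by a directed path of at most two
links with orientations in `C`; disjoint `C`-oriented segments `e₁, …, eₙ`, where `eᵢ` has
endpoints `left i` and `right i` (only the indices `1 ≤ i ≤ n` are used); and two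
points `s`, `t` on none of the segments. -/
structure TourInput where
  C : Finset Plane
  norm_eq_one : ∀ c ∈ C, ‖c‖ = 1
  neg_mem : ∀ c ∈ C, -c ∈ C
  spans : ∀ p q : Plane, ∃ c ∈ C, ∃ c' ∈ C, ∃ r r' : ℝ, 0 ≤ r ∧ 0 ≤ r' ∧ q = p + r • c + r' • c'
  n : ℕ
  left : ℕ → Plane
  right : ℕ → Plane
  oriented : ∀ i, 1 ≤ i → i ≤ n → ∃ c ∈ C, ∃ r : ℝ, 0 < r ∧ right i - left i = r • c
  disjoint : ∀ i j, 1 ≤ i → i < j → j ≤ n →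
    Disjoint (segment ℝ (left i) (right i)) (segment ℝ (left j) (right j))
  s : Plane
  t : Plane
  s_notMem : ∀ i, 1 ≤ i → i ≤ n → s ∉ segment ℝ (left i) (right i)
  t_notMem : ∀ i, 1 ≤ i → i ≤ n → t ∉ segment ℝ (left i) (right i)

namespace TourInput

/-- The sets `e₀ = {s}`, `e₁, …, eₙ` (the segments), `eₙ₊₁ = {t}`. -/
def e (T : TourInput) (i : ℕ) : Set Plane :=
  if i = 0 then {T.s} else if i ≤ T.n then segment ℝ (T.left i) (T.right i) else {T.t}

/-- A `C`-oriented polygonal path starting at `s` with `k` links: link number `m` has orientation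
`dir m` and Euclidean length `len m`. Links of length zero are allowed: they express that a path
makes a turn at a point without being extended. -/
structure LinkPath (T : TourInput) (k : ℕ) where
  dir : Fin k → Plane
  len : Fin k → ℝ
  dir_mem : ∀ m, dir m ∈ T.C
  len_nonneg : ∀ m, 0 ≤ len m

namespace LinkPath

variable {T : TourInput} {k : ℕ}

/-- The parametrization of the path by `[0, k]`: for `m < k`, link number `m` is traversed
at constant speed, in its orientation, over the parameter interval `[m, m + 1]`. -/
noncomputable def point (π : LinkPath T k) (x : ℝ) : Plane :=
  T.s + ∑ m : Fin k, max 0 (min 1 (x - (m : ℕ))) • (π.len m • π.dir m)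

/-- The path visits `e₁, …, eᵢ` in this order. -/
def Visits (π : LinkPath T k) (i : ℕ) : Prop :=
  ∃ τ : ℕ → ℝ, MonotoneOn τ (Set.Icc 1 i) ∧
    ∀ j ∈ Set.Icc 1 i, τ j ∈ Set.Icc (0 : ℝ) k ∧ π.point (τ j) ∈ T.e j

/-- The path visits `e₁, …, eᵢ` in order and ends at the point `q` of `eᵢ`. -/
def EndsAt (π : LinkPath T k) (i : ℕ) (q : Plane) : Prop :=
  π.Visits i ∧ π.point k = q ∧ q ∈ T.e i

/-- The last link has orientation `c`. (The path with no links is regarded as having every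
orientation, so that `e₀` carries the interval `{s}` for every orientation.) -/
def LastDir (π : LinkPath T k) (c : Plane) : Prop :=
  ∀ m : Fin k, (m : ℕ) + 1 = k → π.dir m = c

end LinkPath

/-- `l(eᵢ)`: the least number of links of a path from `s` to `eᵢ` that visits `e₁, …, eᵢ`. -/
noncomputable def l (T : TourInput) (i : ℕ) : ℕ :=
  sInf {k : ℕ | ∃ (π : LinkPath T k) (q : Plane), π.EndsAt i q}

/-- The points of `eᵢ` at which some path with `k` links and last orientation `c` ends. -/
def reach (T : TourInput) (i k : ℕ) (c : Plane) : Set Plane :=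
  {q | ∃ π : LinkPath T k, π.EndsAt i q ∧ π.LastDir c}

/-- The maximal intervals of a subset `R` of a line: its inclusion-maximal nonempty convex subsets
(a single point counts as an interval). -/
def maximalIntervals (R : Set Plane) : Set (Set Plane) :=
  {J | Maximal (fun K : Set Plane => K.Nonempty ∧ Convex ℝ K ∧ K ⊆ R) J}

/-- `I(eᵢ, c)`. -/
noncomputable def I (T : TourInput) (i : ℕ) (c : Plane) : Set (Set Plane) :=
  maximalIntervals (T.reach i (T.l i) c)

/-- `I⁺(eᵢ, c)`. -/
noncomputable def IPlus (T : TourInput) (i : ℕ) (c : Plane) : Set (Set Plane) :=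
  maximalIntervals (T.reach i (T.l i + 1) c)

end TourInput

/-!
The bound holds for paths with any number `k` of links, not only for `k = l(eᵢ)` and
`k = l(eᵢ) + 1`: by induction on `i`, for all `k` and `c` simultaneously, the set `reach i k c` is a
union of `2 * i + 1` convex sets (`isUnionOfConvex_reach`). On a line, such a union has at most
that many maximal intervals (`encard_maximalIntervals_le`).

For the induction step, let `q` be a point of `eᵢ₊₁` reached with `k` links, the last one of
orientation `c`, and let `p` be the point of `eᵢ` visited before. If `p` lies on the last link, then
`q` lies on the ray from `p` in direction `c`; the rays from one convex piece of `reach i k c` meet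
`eᵢ₊₁` in one convex set. If `p` lies on the last but one link, of orientation `d`, then `q` lies in
the cone at `p` spanned by `d` and `c`, all of which is reached. A segment that meets this cone
without meeting its side of direction `c` has an endpoint in the cone (`endpoint_mem_cone`).
If two further links separate `p` from `q`, then either `q` is reached as before, or all points of a
closed half-plane containing `q` are reached (`cone_or_halfPlane_of_mem_cone₃`), and the half-plane
contains an endpoint of `eᵢ₊₁`. Three further links lead anywhere.

Pieces of `eᵢ₊₁` that share an endpoint of it merge, so these cases add at most two pieces in all.
What remains are points reached from `eᵢ` on a single line of direction `c`: upwards, from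
`reach i k c`, or, when the cone degenerates because `d = -c`, downwards, from
`reach i (k - 1) (-c)`. Since `eᵢ` and `eᵢ₊₁` are disjoint and convex, only one of the two
alternatives occurs (`not_ray_or_not_ray_neg`), so only one of the two families of `2 * i + 1` pieces
has to be counted.
-/

namespace TourInput

open scoped Pointwise

/-! ### Convex pieces of a subset of a segment -/

/-- A set that is the union of `N` convex sets, some of which may be empty or coincide. -/
def IsUnionOfConvex (N : ℕ) (R : Set Plane) : Prop :=
  ∃ f : Fin N → Set Plane, (∀ j, Convex ℝ (f j)) ∧ R = ⋃ j, f j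

theorem inner_injOn_segment (a b : Plane) :
    Set.InjOn (fun x : Plane => inner ℝ (b - a) x) (segment ℝ a b) := by
  intro x hx y hy hxy
  rw [segment_eq_image'] at hx hy
  obtain ⟨u, -, rfl⟩ := hx
  obtain ⟨v, -, rfl⟩ := hy
  simp only [inner_add_right, inner_smul_right, add_right_inj] at hxy
  by_cases h : b - a = 0
  · simp [h]
  · have : inner ℝ (b - a) (b - a) ≠ 0 := by simpa using h
    rw [mul_right_cancel₀ this hxy]

/-- On a line, connected sets are convex. -/
theorem convex_of_isPreconnected {a b : Plane} {S : Set Plane} (hS : S ⊆ segment ℝ a b)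
    (h : IsPreconnected S) : Convex ℝ S := by
  set φ : Plane → ℝ := fun x => inner ℝ (b - a) x with hφ
  have hφl : IsLinearMap ℝ φ :=
    ⟨fun x y => inner_add_right _ _ _, fun r x => by simp [hφ, inner_smul_right]⟩
  have hφc : Continuous φ := by fun_prop
  have himg : Convex ℝ (φ '' S) :=
    Real.convex_iff_isPreconnected.2 (h.image φ hφc.continuousOn)
  have : S = segment ℝ a b ∩ φ ⁻¹' (φ '' S) := by
    ext x
    refine ⟨fun hx => ⟨hS hx, x, hx, rfl⟩, ?_⟩
    rintro ⟨hx, y, hy, hyx⟩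
    rwa [← inner_injOn_segment a b (hS hy) hx hyx]
  rw [this]
  exact (convex_segment a b).inter (himg.is_linear_preimage hφl)

theorem convex_union_of_meet {a b : Plane} {A B : Set Plane} (hA : A ⊆ segment ℝ a b)
    (hB : B ⊆ segment ℝ a b) (cA : Convex ℝ A) (cB : Convex ℝ B) (h : (A ∩ B).Nonempty) :
    Convex ℝ (A ∪ B) :=
  convex_of_isPreconnected (Set.union_subset hA hB)
    (cA.isPreconnected.union' h cB.isPreconnected)

/-- The part of `R` that is joined to `M` inside `R`: the union of all convex subsets of `R` that
meet `M`. -/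
def joined (R M : Set Plane) : Set Plane :=
  ⋃₀ {K | Convex ℝ K ∧ K ⊆ R ∧ (K ∩ M).Nonempty}

theorem joined_subset (R M : Set Plane) : joined R M ⊆ R :=
  Set.sUnion_subset fun _ hK => hK.2.1

theorem convex_joined {a b : Plane} {R M : Set Plane} (hR : R ⊆ segment ℝ a b)
    (cM : Convex ℝ M) (hM : M ⊆ R) : Convex ℝ (joined R M) := by
  rcases M.eq_empty_or_nonempty with rfl | ⟨x, hx⟩
  · simp [joined, convex_empty]
  have key : joined R M = ⋃₀ {K | ∃ L, (Convex ℝ L ∧ L ⊆ R ∧ (L ∩ M).Nonempty) ∧ K = L ∪ M} := by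
    ext y
    constructor
    · rintro ⟨K, hK, hy⟩
      exact ⟨K ∪ M, ⟨K, hK, rfl⟩, Or.inl hy⟩
    · rintro ⟨K, ⟨L, hL, rfl⟩, hy⟩
      exact ⟨L ∪ M, ⟨convex_union_of_meet (hL.2.1.trans hR) (hM.trans hR) hL.1 cM hL.2.2,
        Set.union_subset hL.2.1 hM, x, Or.inr hx, hx⟩, hy⟩
  refine convex_of_isPreconnected ((joined_subset R M).trans hR) ?_
  rw [key]
  refine isPreconnected_sUnion x _ ?_ ?_
  · rintro _ ⟨L, -, rfl⟩
    exact Or.inr hx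
  · rintro _ ⟨L, hL, rfl⟩
    exact (convex_union_of_meet (hL.2.1.trans hR) (hM.trans hR) hL.1 cM hL.2.2).isPreconnected

/-- Convex sets all of which contain the same endpoint of the segment merge into one; hence the two
extra pieces. -/
theorem isUnionOfConvex_add_two {a b : Plane} {R : Set Plane} (hR : R ⊆ segment ℝ a b) {N : ℕ}
    (f : Fin N → Set Plane) (hf : ∀ j, Convex ℝ (f j)) (hfR : ∀ j, f j ⊆ R)
    (h : ∀ q ∈ R, ∃ K, Convex ℝ K ∧ q ∈ K ∧ K ⊆ R ∧ (a ∈ K ∨ b ∈ K ∨ ∃ j, (K ∩ f j).Nonempty)) :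
    IsUnionOfConvex (N + 2) R := by
  have single : ∀ x : Plane, Convex ℝ (joined R ({x} ∩ R)) := fun x =>
    convex_joined hR ((Set.subsingleton_singleton.anti Set.inter_subset_left).convex)
      Set.inter_subset_right
  refine ⟨Fin.cons (joined R ({a} ∩ R)) (Fin.cons (joined R ({b} ∩ R))
    fun j => joined R (f j)), ?_, ?_⟩
  · simp only [Fin.forall_fin_succ, Fin.cons_zero, Fin.cons_succ]
    exact ⟨single a, single b, fun j => convex_joined hR (hf j) (hfR j)⟩
  · ext q
    simp only [Set.mem_iUnion, Fin.exists_fin_succ, Fin.cons_zero, Fin.cons_succ]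
    constructor
    · intro hq
      obtain ⟨K, cK, hqK, hKR, ha | hb | ⟨j, hj⟩⟩ := h q hq
      · exact Or.inl ⟨K, ⟨cK, hKR, a, ha, rfl, hKR ha⟩, hqK⟩
      · exact Or.inr (Or.inl ⟨K, ⟨cK, hKR, b, hb, rfl, hKR hb⟩, hqK⟩)
      · exact Or.inr (Or.inr ⟨j, K, ⟨cK, hKR, hj⟩, hqK⟩)
    · rintro (hq | hq | ⟨j, hq⟩) <;> exact joined_subset _ _ hq

theorem isUnionOfConvex_of_subsingleton {R : Set Plane} (h : R.Subsingleton) (N : ℕ) :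
    IsUnionOfConvex (N + 1) R :=
  ⟨fun _ => R, fun _ => h.convex, (Set.iUnion_const R).symm⟩

theorem encard_maximalIntervals_le {a b : Plane} {R : Set Plane} (hR : R ⊆ segment ℝ a b) {N : ℕ}
    (h : IsUnionOfConvex N R) : (maximalIntervals R).encard ≤ N := by
  obtain ⟨f, hf, rfl⟩ := h
  have meets : ∀ J ∈ maximalIntervals (⋃ j, f j), ∃ j, (J ∩ f j).Nonempty := by
    rintro J ⟨⟨⟨x, hx⟩, -, hJ⟩, -⟩
    obtain ⟨j, hj⟩ := Set.mem_iUnion.1 (hJ hx)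
    exact ⟨j, x, hx, hj⟩
  -- A maximal interval absorbs every piece that it meets.
  have absorb : ∀ J ∈ maximalIntervals (⋃ j, f j), ∀ K, Convex ℝ K → K ⊆ ⋃ j, f j →
      (J ∩ K).Nonempty → K ⊆ J := by
    rintro J ⟨⟨hne, cJ, hJ⟩, hmax⟩ K cK hK hJK
    exact Set.subset_union_right.trans (hmax ⟨hne.mono Set.subset_union_left,
      convex_union_of_meet (hJ.trans hR) (hK.trans hR) cJ cK hJK, Set.union_subset hJ hK⟩
      Set.subset_union_left)
  rcases (maximalIntervals (⋃ j, f j)).eq_empty_or_nonempty with h0 | ⟨J₀, hJ₀⟩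
  · simp [h0]
  have : Nonempty (Fin N) := ⟨(meets J₀ hJ₀).choose⟩
  choose! g hg using meets
  have inj : Set.InjOn g (maximalIntervals (⋃ j, f j)) := by
    have sub : ∀ J ∈ maximalIntervals (⋃ j, f j), ∀ J' ∈ maximalIntervals (⋃ j, f j),
        g J = g J' → J' ⊆ J := by
      intro J hJ J' hJ' e
      have h1 : f (g J) ⊆ J := absorb J hJ _ (hf _) (Set.subset_iUnion f _) (hg J hJ)
      obtain ⟨x, hxJ, hx⟩ := hg J' hJ'
      exact absorb J hJ J' hJ'.1.2.1 hJ'.1.2.2 ⟨x, h1 (e ▸ hx), hxJ⟩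
    intro J hJ J' hJ' e
    exact (sub J' hJ' J hJ e.symm).antisymm (sub J hJ J' hJ' e)
  calc (maximalIntervals (⋃ j, f j)).encard ≤ (Set.univ : Set (Fin N)).encard :=
        Set.encard_le_encard_of_injOn (fun _ _ => Set.mem_univ _) inj
    _ = N := by simp

/-! ### Cones in the plane -/

/-- The determinant of two vectors of the plane. -/
def cross (c z : Plane) : ℝ := c 0 * z 1 - c 1 * z 0

theorem cross_add (c y z : Plane) : cross c (y + z) = cross c y + cross c z := by
  simp [cross]; ring

theorem cross_smul (c z : Plane) (r : ℝ) : cross c (r • z) = r * cross c z := by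
  simp [cross]; ring

theorem cross_self (c : Plane) : cross c c = 0 := by
  simp [cross]; ring

/-- Cramer's rule. -/
theorem eq_smul_add_smul {c d : Plane} (h : cross c d ≠ 0) (z : Plane) :
    z = (cross c z / cross c d) • d + (-cross d z / cross c d) • c := by
  ext i
  fin_cases i <;> simp <;> field_simp <;> simp [cross] <;> ring

theorem exists_eq_smul_of_cross_eq_zero {c z : Plane} (hc : ‖c‖ = 1) (h : cross c z = 0) :
    ∃ y : ℝ, z = y • c := by
  have hc' : c 0 ^ 2 + c 1 ^ 2 = 1 := by
    have := EuclideanSpace.real_norm_sq_eq c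
    rw [hc, Fin.sum_univ_two] at this
    linarith
  have hx : c 0 * z 1 - c 1 * z 0 = 0 := h
  refine ⟨c 0 * z 0 + c 1 * z 1, ?_⟩
  ext i
  fin_cases i
  · simp only [Fin.zero_eta, PiLp.smul_apply, smul_eq_mul]
    linear_combination (-z 0) * hc' - c 1 * hx
  · simp only [Fin.mk_one, PiLp.smul_apply, smul_eq_mul]
    linear_combination (-z 1) * hc' + c 0 * hx

theorem eq_or_eq_neg_of_cross_eq_zero {c d : Plane} (hc : ‖c‖ = 1) (hd : ‖d‖ = 1)
    (h : cross c d = 0) : d = c ∨ d = -c := by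
  obtain ⟨y, rfl⟩ := exists_eq_smul_of_cross_eq_zero hc h
  rw [norm_smul, hc, mul_one, Real.norm_eq_abs] at hd
  rcases eq_or_eq_neg_of_abs_eq hd with rfl | rfl
  · exact Or.inl (one_smul ℝ c)
  · exact Or.inr (by rw [neg_smul, one_smul])

/-- The ray from the origin in direction `c`. -/
def ray (c : Plane) : Set Plane := {z | ∃ r : ℝ, 0 ≤ r ∧ z = r • c}

theorem convex_ray (c : Plane) : Convex ℝ (ray c) := by
  rintro _ ⟨r, hr, rfl⟩ _ ⟨r', hr', rfl⟩ u v hu hv -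
  exact ⟨u * r + v * r', by positivity, by module⟩

/-- The cone with apex `p` spanned by `d` and `c`. -/
def cone (p d c : Plane) : Set Plane := {z | ∃ u v : ℝ, 0 ≤ u ∧ 0 ≤ v ∧ z = p + u • d + v • c}

theorem convex_cone (p d c : Plane) : Convex ℝ (cone p d c) := by
  rintro _ ⟨u, v, hu, hv, rfl⟩ _ ⟨u', v', hu', hv', rfl⟩ α β hα hβ h
  refine ⟨α * u + β * u', α * v + β * v', by positivity, by positivity, ?_⟩
  obtain rfl : β = 1 - α := by linarith
  module

/-- A segment that runs into the cone without meeting its side of direction `c` ends in the cone. -/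
theorem endpoint_mem_cone {a b p c d q : Plane} (h : cross c d ≠ 0) (hq : q ∈ segment ℝ a b)
    (hqc : q ∈ cone p d c) (hray : ∀ r : ℝ, 0 ≤ r → p + r • c ∉ segment ℝ a b) :
    a ∈ cone p d c ∨ b ∈ cone p d c := by
  have coord : ∀ z : Plane, ∃ u v : ℝ, z = p + u • d + v • c := fun z =>
    ⟨_, _, by rw [add_assoc, ← eq_smul_add_smul h (z - p)]; abel⟩
  obtain ⟨u, v, hu, hv, hquv⟩ := hqc
  -- Coming from outside, the segment would have to enter the cone through the forbidden side.
  have enter : ∀ z ∈ segment ℝ a b, ∀ x y : ℝ, z = p + x • d + y • c → 0 ≤ y → 0 ≤ x := by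
    intro z hz x y hzxy hy
    by_contra! hx
    have hpos : 0 < u - x := by linarith
    refine hray (u / (u - x) * y + -x / (u - x) * v) ?_ ?_
    · have : 0 ≤ -x := by linarith
      positivity
    · have hw : p + (u / (u - x) * y + -x / (u - x) * v) • c
          = (u / (u - x)) • z + (-x / (u - x)) • q := by
        rw [hzxy, hquv]
        have h1 : -x / (u - x) = 1 - u / (u - x) := by field_simp; ring
        have h2 : u / (u - x) * x + -x / (u - x) * u = 0 := by field_simp; ring
        have h3 : (u / (u - x) * x + -x / (u - x) * u) • d = 0 := by rw [h2, zero_smul]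
        rw [h1] at h3 ⊢
        linear_combination (norm := module) -h3
      rw [hw]
      refine convex_segment a b hz hq (by positivity) ?_ ?_
      · exact div_nonneg (by linarith) hpos.le
      · field_simp; ring
  obtain ⟨ua, va, ha⟩ := coord a
  obtain ⟨ub, vb, hb⟩ := coord b
  rcases le_or_gt 0 va with hva | hva
  · exact Or.inl ⟨ua, va, enter a (left_mem_segment ℝ a b) _ _ ha hva, hva, ha⟩
  rcases le_or_gt 0 vb with hvb | hvb
  · exact Or.inr ⟨ub, vb, enter b (right_mem_segment ℝ a b) _ _ hb hvb, hvb, hb⟩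
  exfalso
  obtain ⟨α, β, hα, hβ, hαβ, hq'⟩ := hq
  have e : cross d (q - p) = cross d (α • (a - p) + β • (b - p)) := by
    rw [← hq']
    obtain rfl : β = 1 - α := by linarith
    congr 1
    module
  have e1 : q - p = u • d + v • c := by rw [hquv]; abel
  have e2 : a - p = ua • d + va • c := by nth_rw 1 [ha]; abel
  have e3 : b - p = ub • d + vb • c := by nth_rw 1 [hb]; abel
  rw [e1, e2, e3] at e
  simp only [cross_add, cross_smul, cross_self, mul_zero, zero_add] at e
  have hdc : cross d c ≠ 0 := by
    intro h0
    apply h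
    simp only [cross] at h0 ⊢
    linarith
  have e' : v = α * va + β * vb := by
    apply mul_right_cancel₀ hdc
    linarith
  have : α • va + β • vb < 0 := convex_Iio (0 : ℝ) hva hvb hα hβ hαβ
  simp only [smul_eq_mul] at this
  linarith

theorem endpoint_mem_halfPlane {a b q p c : Plane} {x : ℝ} (hq : q ∈ segment ℝ a b)
    (hqx : 0 ≤ cross c (q - p) * x) : 0 ≤ cross c (a - p) * x ∨ 0 ≤ cross c (b - p) * x := by
  by_contra! h
  obtain ⟨α, β, hα, hβ, hαβ, rfl⟩ := hq
  have e : α • a + β • b - p = α • (a - p) + β • (b - p) := by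
    obtain rfl : β = 1 - α := by linarith
    module
  rw [e, cross_add, cross_smul, cross_smul] at hqx
  have := convex_Iio (0 : ℝ) h.1 h.2 hα hβ hαβ
  simp only [smul_eq_mul, Set.mem_Iio] at this
  linarith

theorem convex_halfPlane (p c : Plane) (x : ℝ) : Convex ℝ {z | 0 ≤ cross c (z - p) * x} := by
  intro y hy z hz α β hα hβ hαβ
  have e : α • y + β • z - p = α • (y - p) + β • (z - p) := by
    obtain rfl : β = 1 - α := by linarith
    module
  simp only [Set.mem_ofPred_eq] at *
  rw [e, cross_add, cross_smul, cross_smul]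
  nlinarith [mul_nonneg hα hy, mul_nonneg hβ hz]

/-- The vectors covered by three consecutive links of directions `d`, `d'`, `c`. -/
def cone₃ (d d' c : Plane) : Set Plane :=
  {z | ∃ u v w : ℝ, 0 ≤ u ∧ 0 ≤ v ∧ 0 ≤ w ∧ z = u • d + v • d' + w • c}

/-- A vector covered by three links, the last one of direction `c`, is covered by two of them, or
else the whole closed half-plane on its side of the line spanned by `c` is covered by three links,
possibly after the second direction has been replaced with `-c`. -/
theorem cone_or_halfPlane_of_mem_cone₃ {c d d' z : Plane} (hc : ‖c‖ = 1) (hd : ‖d‖ = 1)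
    (hz : z ∈ cone₃ d d' c) (hx : cross c z ≠ 0) :
    z ∈ cone 0 d' c ∨ {w | 0 ≤ cross c w * cross c z} ⊆ cone₃ d (-c) c ∨
      {w | 0 ≤ cross c w * cross c z} ⊆ cone₃ d d' c := by
  obtain ⟨u, v, w, hu, hv, hw, hzeq⟩ := hz
  have hcz : cross c z = u * cross c d + v * cross c d' := by
    rw [hzeq]; simp only [cross_add, cross_smul, cross_self]; ring
  have quot : ∀ {x y t : ℝ}, 0 ≤ x * t → 0 < y * t → 0 ≤ x / y := by
    intro x y t h1 h2
    have ht : t ≠ 0 := by rintro rfl; simp at h2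
    have hy : y ≠ 0 := by rintro rfl; simp at h2
    have : x / y = x * t / (y * t) := by field_simp
    rw [this]
    exact div_nonneg h1 h2.le
  have hzz : 0 < cross c z * cross c z := mul_self_pos.2 hx
  have hd'pos : cross c d * cross c z ≤ 0 → 0 < cross c d' * cross c z := by
    intro h
    by_contra! h'
    have e : cross c z * cross c z = u * (cross c d * cross c z) + v * (cross c d' * cross c z) := by
      nth_rw 1 [hcz]; ring
    linarith [mul_nonpos_of_nonneg_of_nonpos hu h, mul_nonpos_of_nonneg_of_nonpos hv h']
  rcases lt_trichotomy (cross c d * cross c z) 0 with h | h | h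
  · have h' := hd'pos h.le
    have hd'0 : cross c d' ≠ 0 := by intro h0; simp [h0] at h'
    -- `d = -α d' - β c` with `α > 0`.
    obtain ⟨α, hα⟩ : ∃ α, α = -(cross c d / cross c d') := ⟨_, rfl⟩
    obtain ⟨β, hβ⟩ : ∃ β, β = -(-cross d' d / cross c d') := ⟨_, rfl⟩
    have hdeq : d = (-α) • d' + (-β) • c := by
      rw [hα, hβ, neg_neg, neg_neg]
      exact eq_smul_add_smul hd'0 d
    have hα0 : 0 ≤ α := by
      rw [hα, ← neg_div]
      exact quot (by linarith : 0 ≤ -cross c d * cross c z) h'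
    have hz2 : z = (v - u * α) • d' + (w - u * β) • c := by
      rw [hzeq, hdeq]; module
    have hv2 : 0 ≤ v - u * α := by
      have : v - u * α = cross c z / cross c d' := by
        rw [hα, hcz]; field_simp; ring
      rw [this]
      exact quot hzz.le h'
    rcases le_or_gt 0 (w - u * β) with hw2 | hw2
    · exact Or.inl ⟨_, _, hv2, hw2, by rw [hz2]; abel⟩
    · have hβ0 : 0 < β := by
        by_contra! hβ0
        nlinarith [mul_nonpos_of_nonneg_of_nonpos hu hβ0]
      refine Or.inr (Or.inr fun y hy => ?_)
      have hy0 : 0 ≤ cross c y / cross c d' := quot hy h'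
      have hyeq := eq_smul_add_smul hd'0 y
      obtain ⟨m, hm⟩ : ∃ m, m = cross c y / cross c d' := ⟨_, rfl⟩
      obtain ⟨k, hk⟩ : ∃ k, k = -cross d' y / cross c d' := ⟨_, rfl⟩
      rw [← hm, ← hk] at hyeq
      rw [← hm] at hy0
      rcases le_or_gt 0 k with hk0 | hk0
      · exact ⟨0, m, k, le_rfl, hy0, hk0, by rw [hyeq]; module⟩
      · have hkβ : 0 ≤ -k / β := div_nonneg (by linarith) hβ0.le
        refine ⟨-k / β, m + -k / β * α, 0, hkβ, by positivity, le_rfl, ?_⟩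
        have hkk : k = -(-k / β * β) := by field_simp
        rw [hdeq]
        nth_rw 1 [hyeq, hkk]
        module
  · have h' := hd'pos h.le
    have hd'0 : cross c d' ≠ 0 := by intro h0; simp [h0] at h'
    have hcd : cross c d = 0 := (mul_eq_zero.1 h).resolve_right hx
    rcases eq_or_eq_neg_of_cross_eq_zero hc hd hcd with rfl | rfl
    · exact Or.inl ⟨v, u + w, hv, by positivity, by rw [hzeq]; module⟩
    · refine Or.inr (Or.inr fun y hy => ?_)
      have hy0 : 0 ≤ cross c y / cross c d' := quot hy h'
      have hyeq := eq_smul_add_smul hd'0 y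
      rcases le_total 0 (-cross d' y / cross c d') with hk | hk
      · exact ⟨0, _, _, le_rfl, hy0, hk, by rw [zero_smul, zero_add]; exact hyeq⟩
      · exact ⟨-(-cross d' y / cross c d'), _, 0, by linarith, hy0, le_rfl,
          by nth_rw 1 [hyeq]; module⟩
  · have hd0 : cross c d ≠ 0 := by intro h0; simp [h0] at h
    refine Or.inr (Or.inl fun y hy => ?_)
    have hy0 : 0 ≤ cross c y / cross c d := quot hy h
    have hyeq := eq_smul_add_smul hd0 y
    rcases le_total 0 (-cross d y / cross c d) with hk | hk
    · exact ⟨_, 0, _, hy0, le_rfl, hk, by rw [zero_smul, add_zero]; exact hyeq⟩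
    · exact ⟨_, -(-cross d y / cross c d), 0, hy0, by linarith, le_rfl,
        by nth_rw 1 [hyeq]; module⟩

/-- Of two disjoint convex sets, one cannot be reached from the other both along `c` and
along `-c`. -/
theorem not_ray_or_not_ray_neg {A B : Set Plane} (hA : Convex ℝ A) (hB : Convex ℝ B)
    (h : Disjoint A B) (c : Plane) :
    (∀ p ∈ A, ∀ r : ℝ, 0 ≤ r → p + r • c ∉ B) ∨ (∀ p ∈ A, ∀ r : ℝ, 0 ≤ r → p + r • -c ∉ B) := by
  by_contra! hcon
  obtain ⟨⟨p, hp, r, hr, hpB⟩, p', hp', r', hr', hpB'⟩ := hcon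
  rcases hr.eq_or_lt with rfl | hr
  · exact h.ne_of_mem hp hpB (by simp)
  have hs : 0 < r + r' := by positivity
  have hsum : r' / (r + r') + r / (r + r') = 1 := by field_simp; ring
  have h1 := hA hp hp' (by positivity) (by positivity) hsum
  have h2 := hB hpB hpB' (by positivity) (by positivity) hsum
  refine h.ne_of_mem h1 h2 ?_
  have h3 : r' / (r + r') * r = r / (r + r') * r' := by ring
  have h4 : (r' / (r + r') * r) • c = (r / (r + r') * r') • c := by rw [h3]
  linear_combination (norm := module) -h4

/-! ### Appending a link to a path -/

namespace LinkPath

variable {T : TourInput} {k : ℕ}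

/-- The path `π` followed by a link of orientation `c` and length `r`. -/
def snoc (π : LinkPath T k) {c : Plane} (hc : c ∈ T.C) {r : ℝ} (hr : 0 ≤ r) :
    LinkPath T (k + 1) where
  dir := Fin.snoc (α := fun _ => Plane) π.dir c
  len := Fin.snoc (α := fun _ => ℝ) π.len r
  dir_mem m := by
    refine Fin.lastCases ?_ (fun m => ?_) m
    · simpa using hc
    · simpa using π.dir_mem m
  len_nonneg m := by
    refine Fin.lastCases ?_ (fun m => ?_) m
    · simpa using hr
    · simpa using π.len_nonneg m

theorem exists_eq_snoc (π : LinkPath T (k + 1)) {c : Plane} (h : π.LastDir c) :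
    ∃ (π' : LinkPath T k) (hc : c ∈ T.C) (r : ℝ) (hr : 0 ≤ r), π = π'.snoc hc hr := by
  obtain rfl : π.dir (Fin.last k) = c := h _ (by simp)
  refine ⟨⟨fun m => π.dir m.castSucc, fun m => π.len m.castSucc, fun m => π.dir_mem _,
    fun m => π.len_nonneg _⟩, π.dir_mem _, π.len (Fin.last k), π.len_nonneg _, ?_⟩
  rcases π with ⟨dir, len, h1, h2⟩
  simp only [snoc, LinkPath.mk.injEq]
  exact ⟨(Fin.snoc_init_self dir).symm, (Fin.snoc_init_self len).symm⟩

theorem lastDir_snoc (π : LinkPath T k) {c : Plane} (hc : c ∈ T.C) {r : ℝ} (hr : 0 ≤ r) :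
    (π.snoc hc hr).LastDir c := by
  intro m hm
  obtain rfl : m = Fin.last k := Fin.ext (by simpa using hm)
  simp [snoc]

theorem exists_lastDir (π : LinkPath T k) {c : Plane} (hc : c ∈ T.C) :
    ∃ c' ∈ T.C, π.LastDir c' := by
  cases k with
  | zero => exact ⟨c, hc, fun m => m.elim0⟩
  | succ k =>
    refine ⟨π.dir (Fin.last k), π.dir_mem _, fun m hm => ?_⟩
    rw [show m = Fin.last k from Fin.ext (by simpa using hm)]

theorem point_snoc (π : LinkPath T k) {c : Plane} (hc : c ∈ T.C) {r : ℝ} (hr : 0 ≤ r) (x : ℝ) :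
    (π.snoc hc hr).point x = π.point x + (max 0 (min 1 (x - k)) * r) • c := by
  simp [point, snoc, Fin.sum_univ_castSucc, add_assoc, mul_smul]

theorem point_of_le (π : LinkPath T k) {x : ℝ} (hx : (k : ℝ) ≤ x) : π.point x = π.point k := by
  simp only [point]
  congr 1
  refine Finset.sum_congr rfl fun m _ => ?_
  have hm : ((m : ℕ) : ℝ) + 1 ≤ k := by exact_mod_cast m.2
  rw [min_eq_left (by linarith), min_eq_left (by linarith)]

theorem point_snoc_of_le (π : LinkPath T k) {c : Plane} (hc : c ∈ T.C) {r : ℝ} (hr : 0 ≤ r)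
    {x : ℝ} (hx : x ≤ k) : (π.snoc hc hr).point x = π.point x := by
  rw [point_snoc, max_eq_left ((min_le_right _ _).trans (by linarith)), zero_mul, zero_smul,
    add_zero]

theorem point_snoc_end (π : LinkPath T k) {c : Plane} (hc : c ∈ T.C) {r : ℝ} (hr : 0 ≤ r) :
    (π.snoc hc hr).point (k + 1 : ℕ) = π.point k + r • c := by
  rw [point_snoc, point_of_le π (by simp)]
  simp

/-- The length of the last link can be changed as long as the new link still covers all the
visited points. -/
theorem visits_snoc_of_le (π : LinkPath T k) {c : Plane} (hc : c ∈ T.C) {r r' : ℝ} (hr : 0 ≤ r)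
    (hr' : 0 ≤ r') {i : ℕ} {τ : ℕ → ℝ} (hτ : MonotoneOn τ (Set.Icc 1 i))
    (h : ∀ j ∈ Set.Icc 1 i, τ j ∈ Set.Icc (0 : ℝ) (k + 1 : ℕ) ∧ (π.snoc hc hr).point (τ j) ∈ T.e j)
    (hle : ∀ j ∈ Set.Icc 1 i, max 0 (min 1 (τ j - k)) * r ≤ r') :
    (π.snoc hc hr').Visits i := by
  refine ⟨fun j => min (τ j) k + max 0 (min 1 (τ j - k)) * r / r', ?_, ?_⟩
  · intro j hj j' hj' hjj'
    have := hτ hj hj' hjj'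
    dsimp only
    gcongr
  · intro j hj
    obtain ⟨⟨h0, h1⟩, h2⟩ := h j hj
    have hlej := hle j hj
    dsimp only
    rw [point_snoc] at h2
    have hk0 : (0 : ℝ) ≤ k := Nat.cast_nonneg k
    rcases le_or_gt (τ j) k with hjk | hjk
    · have hz : max 0 (min 1 (τ j - k)) = 0 :=
        max_eq_left ((min_le_right _ _).trans (by linarith))
      simp only [hz, zero_mul, zero_div, add_zero, min_eq_left hjk, zero_smul] at h2 ⊢
      refine ⟨⟨h0, by push_cast; linarith⟩, ?_⟩
      rwa [point_snoc_of_le π hc hr' hjk]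
    · rw [point_of_le π hjk.le] at h2
      set w := max 0 (min 1 (τ j - k)) * r with hw
      have hw0 : 0 ≤ w := by positivity
      have hd0 : 0 ≤ w / r' := by positivity
      have hd1 : w / r' ≤ 1 := div_le_one_of_le₀ hlej hr'
      rw [min_eq_right hjk.le]
      refine ⟨⟨by positivity, by push_cast; linarith⟩, ?_⟩
      rw [point_snoc, point_of_le π (by linarith)]
      rw [add_sub_cancel_left, min_eq_right hd1, max_eq_right hd0]
      -- If `r' = 0`, then the visited point is the end of `π`.
      have hwr : w / r' * r' = w := by
        rcases hr'.eq_or_lt with h | h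
        · rw [← h] at hlej ⊢
          simp [le_antisymm hlej hw0]
        · field_simp
      rwa [hwr]

theorem visits_snoc (π : LinkPath T k) {c : Plane} (hc : c ∈ T.C) {r : ℝ} (hr : 0 ≤ r) {i : ℕ}
    (h : π.Visits i) : (π.snoc hc hr).Visits i := by
  obtain ⟨τ, hτ, h⟩ := h
  refine ⟨τ, hτ, fun j hj => ⟨⟨(h j hj).1.1, ?_⟩, ?_⟩⟩
  · push_cast
    linarith [(h j hj).1.2]
  · rw [point_snoc_of_le π hc hr (h j hj).1.2]
    exact (h j hj).2

theorem Visits.of_succ {π : LinkPath T k} {i : ℕ} (h : π.Visits (i + 1)) : π.Visits i := by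
  obtain ⟨τ, hτ, h⟩ := h
  have hsub : Set.Icc 1 i ⊆ Set.Icc 1 (i + 1) := Set.Icc_subset_Icc_right (by omega)
  exact ⟨τ, hτ.mono hsub, fun j hj => h j (hsub hj)⟩

theorem Visits.succ {π : LinkPath T k} {i : ℕ} (h : π.Visits i) (he : π.point k ∈ T.e (i + 1)) :
    π.Visits (i + 1) := by
  obtain ⟨τ, hτ, h⟩ := h
  have hk : (0 : ℝ) ≤ k := Nat.cast_nonneg k
  refine ⟨fun j => if j ≤ i then τ j else k, ?_, ?_⟩
  · intro j hj j' hj' hjj'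
    dsimp only
    split_ifs with h1 h2 h2
    · exact hτ ⟨hj.1, h1⟩ ⟨hj'.1, h2⟩ hjj'
    · exact (h j ⟨hj.1, h1⟩).1.2
    · omega
    · exact le_rfl
  · intro j hj
    dsimp only
    split_ifs with h1
    · exact h j ⟨hj.1, h1⟩
    · obtain rfl : j = i + 1 := by have := hj.2; omega
      exact ⟨⟨hk, le_rfl⟩, he⟩

end LinkPath

/-! ### Points reached after a given segment -/

variable {T : TourInput} {i k : ℕ} {c c' p q : Plane}

/-- The points of the plane at which some path ends that has `k` links, the last one of orientation
`c`, and visits `e₁, …, eᵢ` in order. -/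
def after (T : TourInput) (i k : ℕ) (c : Plane) : Set Plane :=
  {q | ∃ π : LinkPath T k, π.Visits i ∧ π.point k = q ∧ π.LastDir c}

theorem reach_eq (T : TourInput) (i k : ℕ) (c : Plane) : T.reach i k c = T.after i k c ∩ T.e i := by
  ext q
  constructor
  · rintro ⟨π, ⟨h1, h2, h3⟩, h4⟩
    exact ⟨⟨π, h1, h2, h4⟩, h3⟩
  · rintro ⟨⟨π, h1, h2, h4⟩, h3⟩
    exact ⟨π, ⟨h1, h2, h3⟩, h4⟩

theorem reach_succ_eq (T : TourInput) (i k : ℕ) (c : Plane) :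
    T.reach (i + 1) k c = T.after i k c ∩ T.e (i + 1) := by
  ext q
  constructor
  · rintro ⟨π, ⟨h1, h2, h3⟩, h4⟩
    exact ⟨⟨π, h1.of_succ, h2, h4⟩, h3⟩
  · rintro ⟨⟨π, h1, rfl, h4⟩, h3⟩
    exact ⟨π, ⟨h1.succ h3, rfl, h3⟩, h4⟩

theorem add_mem_after_succ (hq : q ∈ T.after i k c') (hc : c ∈ T.C) {r : ℝ} (hr : 0 ≤ r) :
    q + r • c ∈ T.after i (k + 1) c := by
  obtain ⟨π, h1, rfl, -⟩ := hq
  exact ⟨π.snoc hc hr, π.visits_snoc hc hr h1, π.point_snoc_end hc hr, π.lastDir_snoc hc hr⟩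

theorem mem_after_succ (hq : q ∈ T.after i k c') (hc : c ∈ T.C) : q ∈ T.after i (k + 1) c := by
  simpa using add_mem_after_succ hq hc le_rfl

theorem mem_reach_succ (hq : q ∈ T.reach i k c') (hc : c ∈ T.C) : q ∈ T.reach i (k + 1) c := by
  rw [reach_eq] at hq ⊢
  exact ⟨mem_after_succ hq.1 hc, hq.2⟩

/-- The last link can be prolonged. -/
theorem add_mem_after (hq : q ∈ T.after i (k + 1) c) {r : ℝ} (hr : 0 ≤ r) :
    q + r • c ∈ T.after i (k + 1) c := by
  obtain ⟨π, ⟨τ, hτ, h1⟩, rfl, h3⟩ := hq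
  obtain ⟨π, hc, r₀, hr₀, rfl⟩ := π.exists_eq_snoc h3
  refine ⟨π.snoc hc (add_nonneg hr₀ hr), π.visits_snoc_of_le hc hr₀ _ hτ h1 fun j _ => ?_, ?_,
    π.lastDir_snoc hc _⟩
  · have : max 0 (min 1 (τ j - k)) ≤ 1 := max_le zero_le_one (min_le_left _ _)
    nlinarith
  · rw [π.point_snoc_end, π.point_snoc_end, add_smul, add_assoc]

/-- Either the visit of `eᵢ` can be placed on the last link, or it takes place before. -/
theorem after_cases (hq : q ∈ T.after i (k + 1) c) :
    (∃ p ∈ T.reach i (k + 1) c, ∃ r : ℝ, 0 ≤ r ∧ q = p + r • c) ∨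
      ∃ c' ∈ T.C, ∃ p ∈ T.after i k c', ∃ r : ℝ, 0 ≤ r ∧ q = p + r • c := by
  obtain ⟨π, ⟨τ, hτ, h1⟩, rfl, h3⟩ := hq
  obtain ⟨π, hc, r, hr, rfl⟩ := π.exists_eq_snoc h3
  rw [π.point_snoc_end]
  by_cases hcase : 1 ≤ i ∧ (k : ℝ) < τ i
  · left
    obtain ⟨hi, hki⟩ := hcase
    have hii : i ∈ Set.Icc 1 i := ⟨hi, le_rfl⟩
    set w := max 0 (min 1 (τ i - k)) * r with hw
    have hw0 : 0 ≤ w := by positivity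
    have hwr : w ≤ r := by
      have : max 0 (min 1 (τ i - k)) ≤ 1 := max_le zero_le_one (min_le_left _ _)
      nlinarith
    have hmem := (h1 i hii).2
    rw [π.point_snoc, π.point_of_le hki.le] at hmem
    refine ⟨π.point k + w • c, ?_, r - w, by linarith, by module⟩
    refine ⟨π.snoc hc hw0, ⟨π.visits_snoc_of_le hc hr hw0 hτ h1 fun j hj => ?_,
      π.point_snoc_end hc hw0, hmem⟩, π.lastDir_snoc hc hw0⟩
    have := hτ hj hii hj.2
    rw [hw]
    gcongr
  · right
    obtain ⟨c', hc', hl⟩ := π.exists_lastDir hc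
    refine ⟨c', hc', π.point k, ⟨π, ⟨τ, hτ, fun j hj => ?_⟩, rfl, hl⟩, r, hr, rfl⟩
    have hle : τ j ≤ k := by
      have hi : 1 ≤ i := hj.1.trans hj.2
      have := hτ hj ⟨hi, le_rfl⟩ hj.2
      have : ¬ (k : ℝ) < τ i := fun h => hcase ⟨hi, h⟩
      linarith
    refine ⟨⟨(h1 j hj).1.1, hle⟩, ?_⟩
    rw [← π.point_snoc_of_le hc hr hle]
    exact (h1 j hj).2

theorem eq_of_mem_after_zero (hq : q ∈ T.after i 0 c) : q = T.s := by
  obtain ⟨π, -, rfl, -⟩ := hq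
  simp [LinkPath.point]

theorem mem_reach_of_mem_after_zero (hq : q ∈ T.after i 0 c) : q ∈ T.reach i 0 c := by
  rw [reach_eq]
  refine ⟨hq, ?_⟩
  rw [eq_of_mem_after_zero hq]
  rcases Nat.eq_zero_or_pos i with rfl | hi
  · simp [e]
  · obtain ⟨π, ⟨τ, -, h⟩, -, -⟩ := hq
    simpa [LinkPath.point] using (h i ⟨hi, le_rfl⟩).2

/-- Two links lead anywhere; a third one, of length zero, gives the prescribed last orientation. -/
theorem mem_after_add_three (hp : p ∈ T.after i k c') (hc : c ∈ T.C) (q : Plane) :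
    q ∈ T.after i (k + 3) c := by
  obtain ⟨d, hd, d', hd', r, r', hr, hr', rfl⟩ := T.spans p q
  exact mem_after_succ (add_mem_after_succ (add_mem_after_succ hp hd hr) hd' hr') hc

theorem cone_subset_after (hp : p ∈ T.reach i (k + 1) c') (hc : c ∈ T.C) :
    cone p c' c ⊆ T.after i (k + 2) c := by
  rintro _ ⟨u, v, hu, hv, rfl⟩
  rw [reach_eq] at hp
  exact add_mem_after_succ (add_mem_after hp.1 hu) hc hv

theorem add_cone₃_mem_after {z d : Plane} (hp : p ∈ T.reach i (k + 1) c') (hd : d ∈ T.C)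
    (hc : c ∈ T.C) (hz : z ∈ cone₃ c' d c) : p + z ∈ T.after i (k + 3) c := by
  obtain ⟨u, v, w, hu, hv, hw, rfl⟩ := hz
  rw [reach_eq] at hp
  have := add_mem_after_succ (add_mem_after_succ (add_mem_after hp.1 hu) hd hv) hc hw
  rw [show p + (u • c' + v • d + w • c) = p + u • c' + v • d + w • c by abel]
  exact this

theorem add_ray_subset_after {S : Set Plane} (hS : S ⊆ T.reach i (k + 1) c) :
    S + ray c ⊆ T.after i (k + 1) c := by
  rintro _ ⟨p, hp, _, ⟨r, hr, rfl⟩, rfl⟩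
  have := hS hp
  rw [reach_eq] at this
  exact add_mem_after this.1 hr

/-! ### Counting the pieces -/

theorem e_succ (hi : i + 1 ≤ T.n) : T.e (i + 1) = segment ℝ (T.left (i + 1)) (T.right (i + 1)) := by
  simp [e, hi]

theorem exists_e_eq_segment (T : TourInput) (i : ℕ) : ∃ a b, T.e i = segment ℝ a b := by
  unfold e
  split_ifs
  · exact ⟨T.s, T.s, (segment_same ℝ _).symm⟩
  · exact ⟨_, _, rfl⟩
  · exact ⟨T.t, T.t, (segment_same ℝ _).symm⟩

theorem disjoint_e_succ (hi : i + 1 ≤ T.n) : Disjoint (T.e i) (T.e (i + 1)) := by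
  rw [e_succ hi]
  rcases Nat.eq_zero_or_pos i with rfl | h
  · simpa [e] using T.s_notMem 1 le_rfl hi
  · have : T.e i = segment ℝ (T.left i) (T.right i) := by
      simp [e, h.ne', (Nat.le_succ i).trans hi]
    rw [this]
    exact T.disjoint i (i + 1) h (Nat.lt_succ_self i) hi

/-- The set `K` contains `a` or `b`, or it meets the ray of direction `c` from a point of
`reach i (k + 2) c`, or the ray of direction `-c` from a point of `reach i (k + 1) (-c)`. -/
def Anchored (T : TourInput) (i k : ℕ) (c a b : Plane) (K : Set Plane) : Prop :=
  a ∈ K ∨ b ∈ K ∨ (∃ p ∈ T.reach i (k + 2) c, ∃ r : ℝ, 0 ≤ r ∧ p + r • c ∈ K) ∨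
    ∃ p ∈ T.reach i (k + 1) (-c), ∃ r : ℝ, 0 ≤ r ∧ p + r • -c ∈ K

/-- Every point reached on `eᵢ₊₁` lies in an anchored convex set of reached points: the point
itself, a cone, a half-plane or the whole plane, each intersected with `eᵢ₊₁`. -/
theorem exists_convex_anchored {a b : Plane} (hE : T.e (i + 1) = segment ℝ a b) (hc : c ∈ T.C)
    (hq : q ∈ T.reach (i + 1) (k + 2) c) :
    ∃ K, Convex ℝ K ∧ q ∈ K ∧ K ⊆ T.reach (i + 1) (k + 2) c ∧ Anchored T i k c a b K := by
  have ha : a ∈ segment ℝ a b := left_mem_segment ℝ a b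
  have hb : b ∈ segment ℝ a b := right_mem_segment ℝ a b
  rw [reach_succ_eq, hE] at hq ⊢
  obtain ⟨hqF, hqE⟩ := hq
  have point : Anchored T i k c a b {q} → ∃ K, Convex ℝ K ∧ q ∈ K ∧
      K ⊆ T.after i (k + 2) c ∩ segment ℝ a b ∧ Anchored T i k c a b K := fun h =>
    ⟨{q}, convex_singleton q, rfl, Set.singleton_subset_iff.2 ⟨hqF, hqE⟩, h⟩
  have one : ∀ p ∈ T.reach i (k + 2) c, ∀ r : ℝ, 0 ≤ r → q = p + r • c →
      ∃ K, Convex ℝ K ∧ q ∈ K ∧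
        K ⊆ T.after i (k + 2) c ∩ segment ℝ a b ∧ Anchored T i k c a b K := by
    intro p hp r hr hqp
    exact point (Or.inr (Or.inr (Or.inl ⟨p, hp, r, hr, hqp.symm⟩)))
  have two : ∀ d ∈ T.C, ∀ p ∈ T.reach i (k + 1) d, q ∈ cone p d c →
      ∃ K, Convex ℝ K ∧ q ∈ K ∧
        K ⊆ T.after i (k + 2) c ∩ segment ℝ a b ∧ Anchored T i k c a b K := by
    intro d hd p hp hqp
    by_cases hcd : cross c d = 0
    · obtain ⟨u, v, hu, hv, hquv⟩ := hqp
      rcases eq_or_eq_neg_of_cross_eq_zero (T.norm_eq_one c hc) (T.norm_eq_one d hd) hcd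
        with rfl | rfl
      · exact one p (mem_reach_succ hp hc) (u + v) (by positivity) (by rw [hquv]; module)
      · rcases le_total u v with huv | huv
        · exact one p (mem_reach_succ hp hc) (v - u) (by linarith) (by rw [hquv]; module)
        · refine point (Or.inr (Or.inr (Or.inr ⟨p, hp, u - v, by linarith, ?_⟩)))
          rw [Set.mem_singleton_iff, hquv]
          module
    · refine ⟨cone p d c ∩ segment ℝ a b, (convex_cone p d c).inter (convex_segment a b),
        ⟨hqp, hqE⟩, Set.inter_subset_inter_left _ (cone_subset_after hp hc), ?_⟩
      by_cases hray : ∃ r : ℝ, 0 ≤ r ∧ p + r • c ∈ segment ℝ a b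
      · obtain ⟨r, hr, hpr⟩ := hray
        exact Or.inr (Or.inr (Or.inl ⟨p, mem_reach_succ hp hc, r, hr,
          ⟨0, r, le_rfl, hr, by simp⟩, hpr⟩))
      · push Not at hray
        rcases endpoint_mem_cone hcd hqE hqp hray with h | h
        · exact Or.inl ⟨h, ha⟩
        · exact Or.inr (Or.inl ⟨h, hb⟩)
  rcases after_cases hqF with ⟨p, hp, r, hr, hqp⟩ | ⟨d', hd', q₁, hq₁, r, hr, hqq₁⟩
  · exact one p hp r hr hqp
  rcases after_cases hq₁ with ⟨p, hp, r', hr', hqp⟩ | ⟨d, hd, q₂, hq₂, r', hr', hq₁q₂⟩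
  · exact two d' hd' p hp ⟨r', r, hr', hr, by rw [hqq₁, hqp]⟩
  cases k with
  | zero =>
    exact two d' hd' q₂ (mem_reach_succ (mem_reach_of_mem_after_zero hq₂) hd')
      ⟨r', r, hr', hr, by rw [hqq₁, hq₁q₂]⟩
  | succ k =>
    rcases after_cases hq₂ with ⟨p, hp, r'', hr'', hqp⟩ | ⟨d'', -, q₃, hq₃, -⟩
    · have hz : q - p ∈ cone₃ d d' c :=
        ⟨r'', r', r, hr'', hr', hr, by rw [hqq₁, hq₁q₂, hqp]; abel⟩
      have hc' := T.neg_mem c hc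
      by_cases hx : cross c (q - p) = 0
      · -- `q` lies on the line through `p` of direction `c`.
        obtain ⟨y, hy⟩ := exists_eq_smul_of_cross_eq_zero (T.norm_eq_one c hc) hx
        rw [sub_eq_iff_eq_add'] at hy
        refine two (-c) hc' p (mem_reach_succ hp hc') ?_
        rcases le_total 0 y with hy0 | hy0
        · exact ⟨0, y, le_rfl, hy0, by rw [hy]; module⟩
        · exact ⟨-y, 0, by linarith, le_rfl, by rw [hy]; module⟩
      · have half : (∃ δ ∈ T.C, {w | 0 ≤ cross c w * cross c (q - p)} ⊆ cone₃ d δ c) →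
            ∃ K, Convex ℝ K ∧ q ∈ K ∧ K ⊆ T.after i (k + 1 + 2) c ∩ segment ℝ a b ∧
              Anchored T i (k + 1) c a b K := by
          rintro ⟨δ, hδ, hsub⟩
          have hqK : 0 ≤ cross c (q - p) * cross c (q - p) := mul_self_nonneg _
          refine ⟨{z | 0 ≤ cross c (z - p) * cross c (q - p)} ∩ segment ℝ a b,
            (convex_halfPlane p c _).inter (convex_segment a b), ⟨hqK, hqE⟩,
            Set.inter_subset_inter_left _ fun z hz => ?_, ?_⟩
          · have := add_cone₃_mem_after hp hδ hc (hsub (a := z - p) hz)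
            rwa [add_sub_cancel] at this
          · rcases endpoint_mem_halfPlane hqE hqK with h | h
            · exact Or.inl ⟨h, ha⟩
            · exact Or.inr (Or.inl ⟨h, hb⟩)
        rcases cone_or_halfPlane_of_mem_cone₃ (T.norm_eq_one c hc) (T.norm_eq_one d hd) hz hx
          with h | h | h
        · obtain ⟨u, v, hu, hv, huv⟩ := h
          refine two d' hd' p (mem_reach_succ hp hd') ⟨u, v, hu, hv, ?_⟩
          rw [← sub_add_cancel q p, huv]
          abel
        · exact half ⟨-c, hc', h⟩
        · exact half ⟨d', hd', h⟩
    · exact ⟨segment ℝ a b, convex_segment a b, hqE,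
        fun z hz => ⟨mem_after_add_three hq₃ hc z, hz⟩, Or.inl ha⟩

/-- The pieces on `eᵢ₊₁` are those swept out from the pieces on `eᵢ`, either in direction `c` or in
direction `-c`, and two more, one for each endpoint. -/
theorem isUnionOfConvex_reach_succ (hi : i + 1 ≤ T.n) {N : ℕ}
    (ih : ∀ k, ∀ c ∈ T.C, IsUnionOfConvex (N + 1) (T.reach i k c)) (k : ℕ) (hc : c ∈ T.C) :
    IsUnionOfConvex (N + 3) (T.reach (i + 1) k c) := by
  have hE := e_succ hi
  set a := T.left (i + 1)
  set b := T.right (i + 1)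
  have hsub : ∀ k, T.reach (i + 1) k c ⊆ segment ℝ a b := fun k => by
    rw [reach_succ_eq, hE]
    exact Set.inter_subset_right
  have hsub' : ∀ {k c}, T.reach i k c ⊆ T.e i := fun {k c} => by
    rw [reach_eq]
    exact Set.inter_subset_right
  match k with
  | 0 =>
    refine isUnionOfConvex_of_subsingleton (fun x hx y hy => ?_) (N + 2)
    rw [reach_eq] at hx hy
    rw [eq_of_mem_after_zero hx.1, eq_of_mem_after_zero hy.1]
  | 1 =>
    obtain ⟨f, hf, hfR⟩ := ih 1 c hc
    refine isUnionOfConvex_add_two (hsub 1) (fun j => (f j + ray c) ∩ segment ℝ a b)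
      (fun j => ((hf j).add (convex_ray c)).inter (convex_segment a b)) (fun j => ?_)
      fun q hq => ?_
    · rw [reach_succ_eq, hE]
      exact Set.inter_subset_inter_left _
        (add_ray_subset_after (hfR ▸ Set.subset_iUnion f j))
    · have hq' := hq
      rw [reach_succ_eq, hE] at hq'
      obtain ⟨p, hp, r, hr, hqp⟩ : ∃ p ∈ T.reach i 1 c, ∃ r : ℝ, 0 ≤ r ∧ q = p + r • c := by
        rcases after_cases hq'.1 with h | ⟨d, -, p, hp, r, hr, hqp⟩
        · exact h
        · exact ⟨p, mem_reach_succ (mem_reach_of_mem_after_zero hp) hc, r, hr, hqp⟩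
      rw [hfR] at hp
      obtain ⟨j, hj⟩ := Set.mem_iUnion.1 hp
      exact ⟨{q}, convex_singleton q, rfl, Set.singleton_subset_iff.2 hq, Or.inr (Or.inr ⟨j, q, rfl,
        ⟨p, hj, r • c, ⟨r, hr, rfl⟩, hqp.symm⟩, hq'.2⟩)⟩
  | k + 2 =>
    have he : Convex ℝ (T.e i) := by
      obtain ⟨a', b', h⟩ := T.exists_e_eq_segment i
      rw [h]
      exact convex_segment a' b'
    rcases not_ray_or_not_ray_neg he (convex_segment a b) (hE ▸ disjoint_e_succ hi) c
      with hno | hno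
    · obtain ⟨f, hf, hfR⟩ := ih (k + 1) (-c) (T.neg_mem c hc)
      refine isUnionOfConvex_add_two (hsub _) (fun j => (f j + ray (-c)) ∩ segment ℝ a b)
        (fun j => ((hf j).add (convex_ray _)).inter (convex_segment a b)) (fun j => ?_)
        fun q hq => ?_
      · rw [reach_succ_eq, hE]
        exact Set.inter_subset_inter_left _ fun x hx => mem_after_succ
          (add_ray_subset_after (hfR ▸ Set.subset_iUnion f j) hx) hc
      · obtain ⟨K, cK, hqK, hK, h⟩ := exists_convex_anchored hE hc hq
        refine ⟨K, cK, hqK, hK, h.imp_right (Or.imp_right ?_)⟩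
        rintro (⟨p, hp, r, hr, hpr⟩ | ⟨p, hp, r, hr, hpr⟩)
        · exact absurd (hsub _ (hK hpr)) (hno p (hsub' hp) r hr)
        · rw [hfR] at hp
          obtain ⟨j, hj⟩ := Set.mem_iUnion.1 hp
          exact ⟨j, _, hpr, ⟨p, hj, _, ⟨r, hr, rfl⟩, rfl⟩, hsub _ (hK hpr)⟩
    · obtain ⟨f, hf, hfR⟩ := ih (k + 2) c hc
      refine isUnionOfConvex_add_two (hsub _) (fun j => (f j + ray c) ∩ segment ℝ a b)
        (fun j => ((hf j).add (convex_ray _)).inter (convex_segment a b)) (fun j => ?_)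
        fun q hq => ?_
      · rw [reach_succ_eq, hE]
        exact Set.inter_subset_inter_left _
          (add_ray_subset_after (hfR ▸ Set.subset_iUnion f j))
      · obtain ⟨K, cK, hqK, hK, h⟩ := exists_convex_anchored hE hc hq
        refine ⟨K, cK, hqK, hK, h.imp_right (Or.imp_right ?_)⟩
        rintro (⟨p, hp, r, hr, hpr⟩ | ⟨p, hp, r, hr, hpr⟩)
        · rw [hfR] at hp
          obtain ⟨j, hj⟩ := Set.mem_iUnion.1 hp
          exact ⟨j, _, hpr, ⟨p, hj, _, ⟨r, hr, rfl⟩, rfl⟩, hsub _ (hK hpr)⟩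
        · exact absurd (hsub _ (hK hpr)) (hno p (hsub' hp) r hr)

theorem isUnionOfConvex_reach (T : TourInput) (i : ℕ) :
    ∀ k, ∀ c ∈ T.C, IsUnionOfConvex (2 * i + 1) (T.reach i k c) := by
  -- A one-point `eᵢ` needs no induction. This settles `e₀` and `eₙ₊₁`, which may coincide if `n = 0`.
  have single : ∀ {i : ℕ}, (T.e i).Subsingleton → ∀ k, ∀ c ∈ T.C,
      IsUnionOfConvex (2 * i + 1) (T.reach i k c) := fun h k c _ =>
    isUnionOfConvex_of_subsingleton (h.anti (by rw [reach_eq]; exact Set.inter_subset_right)) _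
  induction i with
  | zero => exact single (by simp [e])
  | succ i ih =>
    by_cases hi : i + 1 ≤ T.n
    · exact fun k c hc => isUnionOfConvex_reach_succ hi ih k hc
    · exact single (by simp [e, hi])

end TourInput

theorem claim6 (T : TourInput) (i : ℕ) (hi : i ≤ T.n + 1) (c : Plane) (hc : c ∈ T.C) :
    (T.I i c).encard ≤ 2 * i + 1 ∧ (T.IPlus i c).encard ≤ 2 * i + 1 := by
  obtain ⟨a, b, hE⟩ := T.exists_e_eq_segment i
  have bound : ∀ k, (TourInput.maximalIntervals (T.reach i k c)).encard ≤ 2 * i + 1 := fun k => by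
    have := TourInput.encard_maximalIntervals_le (a := a) (b := b)
      (by rw [← hE, TourInput.reach_eq]; exact Set.inter_subset_right)
      (T.isUnionOfConvex_reach i k c hc)
    exact_mod_cast this
  exact ⟨bound _, bound _⟩
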